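/- Let $G$ be a finite connected simple graph with a root vertex $u$, let $n$ be a natural number, and let $\alpha\in[0,1)$. A partition of $n$ is a nondecreasing sequence $\mathbf a=(a_1,\dots,a_k)$ of positive integers with sum $n$; its length is $k$. For partitions $\mathbf a=(a_1,\dots,a_k)$ and $\mathbf b=(b_1,\dots,b_p)$ of $n$, $\mathbf a$ precedes $\mathbf b$ in shortlex order if either $k<p$, or $k=p$ and $a_i<b_i$ at the smallest index $i$ at which they differ. Let $G(\mathbf a,u)$ be the graph obtained from $G$ by attaching at $u$, for each $i=1,\dots,k$, a pendant path with $a_i$ edges (and $a_i$ new vertices). For a finite graph $H$ with diagonal degree matrix $D(H)$ and adjacency matrix $A(H)$, let $\rho_\alpha(H)$ be the spectral radius (that is, the largest eigenvalue) of $A_\alpha(H)=\alpha D(H)+(1-\alpha)A(H)$. Let $\mathbf a,\mathbf b$ be partitions of $n$ such that $\mathbf a$ precedes $\mathbf b$ in shortlex order. Then $$\rho_\alpha(G(\mathbf a,u))\le\rho_\alpha(G(\mathbf b,u)).$$ Equality holds if and only if $G(\mathbf a,u)$ and $G(\mathbf b,u)$ are isomorphic, and this happens if and only if $G=K_1$ (a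 single vertex) and $\mathbf b$ has length $2$. -/

import Mathlib

/-- The elements of `𝒫(n)`: nondecreasing sequences of positive integers with sum `n`. -/
def IsPartition (n : ℕ) (a : List ℕ) : Prop :=
  a.Pairwise (· ≤ ·) ∧ (∀ x ∈ a, 0 < x) ∧ a.sum = n

/-- The vertices of `G(a, u)`: those of `G`, and for each index `i` of the list `a` the `a[i]` new
vertices of the `i`-th path. The new vertex `Sum.inr ⟨i, j⟩` is at distance `j + 1` from `u`. -/
abbrev AttachVert (V : Type*) (a : List ℕ) : Type _ :=
  V ⊕ (Σ i : Fin a.length, Fin (a.get i))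

/-- Adjacency in `G(a, u)`. -/
def AttachAdj {V : Type*} (G : SimpleGraph V) (u : V) (a : List ℕ) :
    AttachVert V a → AttachVert V a → Prop
  | Sum.inl x, Sum.inl y => G.Adj x y
  | Sum.inl x, Sum.inr q => x = u ∧ (q.2 : ℕ) = 0
  | Sum.inr p, Sum.inl y => y = u ∧ (p.2 : ℕ) = 0
  | Sum.inr p, Sum.inr q =>
      p.1 = q.1 ∧ ((p.2 : ℕ) + 1 = (q.2 : ℕ) ∨ (q.2 : ℕ) + 1 = (p.2 : ℕ))

/-- The graph `G(a, u)` obtained from `G` by attaching at the vertex `u`, for each entry `k` of the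
list `a`, a pendant path of length `k` (that is, with `k` edges and `k` new vertices). -/
def attachPaths {V : Type*} (G : SimpleGraph V) (u : V) (a : List ℕ) :
    SimpleGraph (AttachVert V a) where
  Adj := AttachAdj G u a
  symm := ⟨by
    rintro (x | p) (y | q) h
    · exact G.adj_symm h
    · exact h
    · exact h
    · exact ⟨h.1.symm, h.2.symm⟩⟩
  loopless := ⟨by
    rintro (x | p) h
    · exact G.irrefl h
    · rcases h.2 with h | h <;> omega⟩

open Classical in
/-- The matrix `A_α(G) = α D(G) + (1 - α) A(G)`, where `D(G)` is the diagonal matrix of the vertex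
degrees and `A(G)` is the adjacency matrix. -/
noncomputable def alphaMatrix {V : Type*} [Fintype V] (G : SimpleGraph V) (α : ℝ) :
    Matrix V V ℝ :=
  α • G.degMatrix ℝ + (1 - α) • G.adjMatrix ℝ

open Classical in
/-- The spectral radius `ρ_α(G)`: the largest eigenvalue of the real symmetric matrix `A_α(G)`. -/
noncomputable def rhoAlpha {V : Type*} [Fintype V] (α : ℝ) (G : SimpleGraph V) : ℝ :=
  sSup (spectrum ℝ (alphaMatrix G α))

theorem alphaMatrix_isHermitian {V : Type*} [Fintype V] (G : SimpleGraph V) (α : ℝ) :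
    (alphaMatrix G α).IsHermitian := by
  classical
  ext i j
  simp only [alphaMatrix, SimpleGraph.degMatrix, Matrix.conjTranspose_apply, Matrix.add_apply,
    Matrix.smul_apply, Matrix.diagonal_apply, SimpleGraph.adjMatrix_apply, star_trivial,
    G.adj_comm j i]
  by_cases h : i = j
  · subst h; rfl
  · simp [h, Ne.symm h]

open Classical in
/-- The supremum in `rhoAlpha` is attained: `rhoAlpha α G` is the greatest eigenvalue. -/
theorem isGreatest_rhoAlpha {V : Type*} [Fintype V] [Nonempty V] (α : ℝ) (G : SimpleGraph V) :
    IsGreatest (spectrum ℝ (alphaMatrix G α)) (rhoAlpha α G) := by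
  have hs := (alphaMatrix_isHermitian G α).spectrum_real_eq_range_eigenvalues
  have hf : (spectrum ℝ (alphaMatrix G α)).Finite := by
    rw [hs]; exact Set.finite_range _
  have hn : (spectrum ℝ (alphaMatrix G α)).Nonempty := by
    rw [hs]; exact Set.range_nonempty _
  exact ⟨hn.csSup_mem hf, fun x hx => le_csSup hf.bddAbove hx⟩

/-!
Suppose that `ρ_α(G(b, u)) ≤ ρ = ρ_α(G(a, u))`. Along a pendant path, read from its free end, the
eigenvalue equation is a three-term recurrence, so the ratios of consecutive entries of a positive
solution satisfy a continued fraction recursion depending on `ρ` and `α` alone. A path with `s`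
edges therefore acts on `G` as an extra diagonal entry `(1 - α) * legWeight β c s` at `u`, and
pairing the restrictions to `G` of the two Perron vectors gives `F b ≤ F a`, where `F` is the sum
of the weights.

On the other hand `F a < F b`. Moving an edge from a path to one that is at least as long makes
`F` smaller, as long as the two weights add up to less than `c + 2 * β`, a bound on `F` which
`ρ` provides. Such moves reduce the comparison to one in which the longest entries of `a` and `b`
agree. There the first entry at which `a` and `b` differ (or, when `a` is shorter, a `0` with which
`a` is padded) decides, because raising this smallest entry by one outweighs all other paths. The
bound on the two weights is attained only when they are all there is, that is, when
`G(b, u)` is a path with `u` in it.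
-/

/-- The ratio `Z (s - 1) / Z s` for an eigenvector of `A_α` to the eigenvalue `ρ` whose entries
along a pendant path, read from the free end, are `Z 0, Z 1, …`. The parameters are
`β = α / (1 - α)` and `c = (ρ - 2 α) / (1 - α)`; the value `-β` at `0` makes the equation at the
free end an instance of the recursion. -/
noncomputable def legRatio (β c : ℝ) : ℕ → ℝ
  | 0 => -β
  | s + 1 => (c - legRatio β c s)⁻¹

/-- The contribution of a pendant path with `s` edges to the eigenvalue equation at its root,
divided by `1 - α` and by the value at the root. -/
noncomputable def legWeight (β c : ℝ) (s : ℕ) : ℝ := β + legRatio β c s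

/-- The total contribution of a family of pendant paths with the given lengths. -/
noncomputable def legWeightSum (β c : ℝ) (s : Multiset ℕ) : ℝ := (s.map (legWeight β c)).sum

/-- The recursion for `legRatio` has positive denominators up to index `N`. -/
def LegValid (β c : ℝ) (N : ℕ) : Prop := ∀ s < N, legRatio β c s < c

theorem add_inv_lt_add_inv {s t : ℝ} (hs : 0 < s) (hst : s < t) (h : s * t < 1) :
    t + t⁻¹ < s + s⁻¹ := by
  have ht : 0 < t := hs.trans hst
  have hdiff : s + s⁻¹ - (t + t⁻¹) = (t - s) * (1 - s * t) / (s * t) := by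
    field_simp
    ring
  have : 0 < (t - s) * (1 - s * t) / (s * t) :=
    div_pos (mul_pos (sub_pos.2 hst) (sub_pos.2 h)) (mul_pos hs ht)
  linarith

theorem exists_add_inv_eq {c : ℝ} (hc : 2 ≤ c) : ∃ τ, 0 < τ ∧ τ ≤ 1 ∧ τ + τ⁻¹ = c := by
  have hsq : √(c ^ 2 - 4) ^ 2 = c ^ 2 - 4 := Real.sq_sqrt (by nlinarith)
  have hS : 0 ≤ √(c ^ 2 - 4) := Real.sqrt_nonneg _
  generalize √(c ^ 2 - 4) = S at hsq hS
  have hinv : ((c - S) / 2)⁻¹ = (c + S) / 2 := inv_eq_of_mul_eq_one_right (by linarith)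
  exact ⟨(c - S) / 2, by nlinarith, by nlinarith, by rw [hinv]; ring⟩

section LegRatio

variable {β c : ℝ} {N : ℕ}

theorem legRatio_zero : legRatio β c 0 = -β := rfl

theorem legRatio_succ (s : ℕ) : legRatio β c (s + 1) = (c - legRatio β c s)⁻¹ := rfl

theorem legRatio_eq_sub_inv (s : ℕ) : legRatio β c s = c - (legRatio β c (s + 1))⁻¹ := by
  rw [legRatio_succ, inv_inv, sub_sub_cancel]

@[simp]
theorem legWeight_zero : legWeight β c 0 = 0 := add_neg_cancel β

theorem legValid_zero : LegValid β c 0 := fun _ hs => absurd hs (Nat.not_lt_zero _)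

theorem LegValid.mono {M : ℕ} (h : LegValid β c N) (hM : M ≤ N) : LegValid β c M :=
  fun s hs => h s (hs.trans_le hM)

theorem LegValid.legRatio_pos (h : LegValid β c N) {s : ℕ} (hs : 0 < s) (hsN : s ≤ N) :
    0 < legRatio β c s := by
  obtain ⟨s, rfl⟩ := Nat.exists_eq_succ_of_ne_zero hs.ne'
  exact inv_pos.2 (sub_pos.2 (h s hsN))

theorem LegValid.strictMonoOn_legRatio (hβ : 0 ≤ β) (h : LegValid β c N) :
    StrictMonoOn (legRatio β c) (Set.Iic N) := by
  refine strictMonoOn_Iic_of_lt_succ fun s hs => ?_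
  rw [Nat.succ_eq_succ]
  induction s with
  | zero => exact (neg_nonpos.2 hβ).trans_lt (h.legRatio_pos one_pos hs)
  | succ s ih => exact inv_strictAnti₀ (sub_pos.2 (h _ hs)) (sub_lt_sub_left (ih (by omega)) c)

theorem LegValid.strictMonoOn_legWeight (hβ : 0 ≤ β) (h : LegValid β c N) :
    StrictMonoOn (legWeight β c) (Set.Iic N) :=
  fun _ hs _ hr hsr => add_lt_add_right (h.strictMonoOn_legRatio hβ hs hr hsr) β

theorem LegValid.legWeight_le (hβ : 0 ≤ β) (h : LegValid β c N) {s r : ℕ} (hsr : s ≤ r)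
    (hr : r ≤ N) : legWeight β c s ≤ legWeight β c r :=
  (h.strictMonoOn_legWeight hβ).monotoneOn (hsr.trans hr) hr hsr

theorem LegValid.legWeight_pos (hβ : 0 ≤ β) (h : LegValid β c N) (hN : 0 < N) :
    0 < legWeight β c N := by
  simpa only [legWeight_zero] using
    h.strictMonoOn_legWeight hβ (Nat.zero_le N) (Set.mem_Iic.2 le_rfl) hN

theorem LegValid.legWeight_nonneg (hβ : 0 ≤ β) (h : LegValid β c N) : 0 ≤ legWeight β c N := by
  simpa only [legWeight_zero] using h.legWeight_le hβ N.zero_le le_rfl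

theorem LegValid.succ_of_add_lt {y v : ℕ} (hv : LegValid β c v) (hyv : y + 1 ≤ v)
    (hsum : legWeight β c (y + 1) + legWeight β c v < c + 2 * β) : LegValid β c (v + 1) := by
  intro s hs
  rcases (Nat.lt_succ_iff.1 hs).eq_or_lt with rfl | hlt
  · have := hv.legRatio_pos y.succ_pos hyv
    unfold legWeight at hsum
    linarith
  · exact hv s hlt

theorem LegValid.legWeight_add_legWeight_succ_lt (hβ : 0 ≤ β) {y v : ℕ} (hv : LegValid β c v)
    (hyv : y + 1 ≤ v) (hsum : legWeight β c (y + 1) + legWeight β c v < c + 2 * β) :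
    legWeight β c y + legWeight β c (v + 1) < legWeight β c (y + 1) + legWeight β c v := by
  have hv' := hv.succ_of_add_lt hyv hsum
  have hden : 0 < c - legRatio β c v := sub_pos.2 (hv' v v.lt_succ_self)
  have hlt_den : legRatio β c (y + 1) < c - legRatio β c v := by
    unfold legWeight at hsum
    linarith
  have hlt_inv : legRatio β c (y + 1) < (c - legRatio β c v)⁻¹ :=
    hv'.strictMonoOn_legRatio hβ (Set.mem_Iic.2 (by omega)) (Set.mem_Iic.2 le_rfl) (by omega)
  have hmul : legRatio β c (y + 1) * (c - legRatio β c v) < 1 := by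
    simpa only [inv_mul_cancel₀ hden.ne'] using mul_lt_mul_of_pos_right hlt_inv hden
  have hkey := add_inv_lt_add_inv (hv.legRatio_pos y.succ_pos hyv) hlt_den hmul
  simp only [legWeight, legRatio_eq_sub_inv y, legRatio_succ v]
  linarith

section FixedPoint

variable {τ : ℝ}

theorem legRatio_lt_of_add_inv_eq (hβ : 0 ≤ β) (hτ : 0 < τ) (hc : τ + τ⁻¹ = c) (s : ℕ) :
    legRatio β c s < τ := by
  induction s with
  | zero => exact (neg_nonpos.2 hβ).trans_lt hτ
  | succ s ih =>
    have hden : τ⁻¹ < c - legRatio β c s := by linarith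
    simpa only [legRatio_succ, inv_inv] using inv_strictAnti₀ (inv_pos.2 hτ) hden

theorem sub_legRatio_succ (hβ : 0 ≤ β) (hτ : 0 < τ) (hc : τ + τ⁻¹ = c) (s : ℕ) :
    τ - legRatio β c (s + 1) = (τ - legRatio β c s) * (τ * legRatio β c (s + 1)) := by
  have hden : 0 < c - legRatio β c s := by
    linarith [legRatio_lt_of_add_inv_eq hβ hτ hc s, inv_pos.2 hτ]
  have hmul : τ * (c - legRatio β c s) = 1 + (τ - legRatio β c s) * τ := by
    rw [← hc, add_sub_right_comm, mul_add, mul_inv_cancel₀ hτ.ne']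
    ring
  rw [legRatio_succ]
  field_simp
  linarith

end FixedPoint

-- The bound `c` is so large that all ratios stay below the smaller root `τ` of `τ + τ⁻¹ = c`, and
-- the distances to `τ` decay at least by the factor `m + 1` from index `x` to index `x + 1`.
theorem legWeight_add_mul_lt_of_add_inv_le (hβ : 0 ≤ β) {m x : ℕ} (w : ℕ) (hm : 0 < m)
    (hx : LegValid β c (x + 1))
    (hc : (m + 1) * legRatio β c (x + 1) + ((m + 1) * legRatio β c (x + 1))⁻¹ ≤ c) :
    legWeight β c x + m * legWeight β c w < (m + 1) * legWeight β c (x + 1) := by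
  have hq : 0 < legRatio β c (x + 1) := hx.legRatio_pos x.succ_pos le_rfl
  have hm' : (0 : ℝ) < m := Nat.cast_pos.2 hm
  set p := (m + 1) * legRatio β c (x + 1)
  have hp0 : 0 < p := by positivity
  have hc2 : 2 ≤ c := by
    have : p + p⁻¹ - 2 = (p - 1) ^ 2 / p := by
      field_simp
      ring
    have : 0 ≤ (p - 1) ^ 2 / p := by positivity
    linarith
  obtain ⟨τ, hτ0, hτ1, hτc⟩ := exists_add_inv_eq hc2
  have hτp : τ * p ≤ 1 := by
    by_contra! hcon
    have hp1 : 1 < p := hcon.trans_le (mul_le_of_le_one_left hp0.le hτ1)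
    have := add_inv_lt_add_inv (inv_pos.2 hp0) ((inv_lt_iff_one_lt_mul₀ hp0).2 hcon)
      (mul_lt_one_of_nonneg_of_lt_one_left (inv_nonneg.2 hp0.le) (inv_lt_one_of_one_lt₀ hp1) hτ1)
    rw [inv_inv] at this
    linarith
  have hdecay : (m + 1) * (τ - legRatio β c (x + 1)) ≤ τ - legRatio β c x := by
    calc (m + 1) * (τ - legRatio β c (x + 1)) = (τ - legRatio β c x) * (τ * p) := by
          rw [sub_legRatio_succ hβ hτ0 hτc]
          ring
      _ ≤ τ - legRatio β c x :=
          mul_le_of_le_one_right (sub_pos.2 (legRatio_lt_of_add_inv_eq hβ hτ0 hτc x)).le hτp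
  have hw := mul_lt_mul_of_pos_left (legRatio_lt_of_add_inv_eq hβ hτ0 hτc w) hm'
  unfold legWeight
  linarith

-- Averaging: `W` is at most `m / (m + 1)` times what the weight `legWeight β c x` leaves of the
-- bound `c + 2 * β`.
theorem legWeight_add_lt_of_lt_add_inv (hβ : 0 ≤ β) {m x w : ℕ} {W : ℝ}
    (hx : LegValid β c (x + 1))
    (hc : c < (m + 1) * legRatio β c (x + 1) + ((m + 1) * legRatio β c (x + 1))⁻¹)
    (hW : W ≤ m * legWeight β c w)
    (hsum : legWeight β c x + W + legWeight β c w ≤ c + 2 * β) :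
    legWeight β c x + W < (m + 1) * legWeight β c (x + 1) := by
  have hq : 0 < legRatio β c (x + 1) := hx.legRatio_pos x.succ_pos le_rfl
  have hm : (0 : ℝ) < m + 1 := by positivity
  have havg : (m + 1) * (legWeight β c x + W) ≤ m * (c + 2 * β) + legWeight β c x := by
    linarith [mul_le_mul_of_nonneg_left hsum m.cast_nonneg]
  have hmc : (m + 1) * c < (m + 1) ^ 2 * legRatio β c (x + 1) + (legRatio β c (x + 1))⁻¹ := by
    calc (m + 1) * c < (m + 1) * _ := mul_lt_mul_of_pos_left hc hm
      _ = _ := by field_simp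
  have hβm : 0 ≤ β * m ^ 2 := by positivity
  refine lt_of_mul_lt_mul_left (havg.trans_lt ?_) hm.le
  simp only [legWeight, legRatio_eq_sub_inv x]
  linarith

end LegRatio

section LegWeightSum

variable {β c : ℝ}

@[simp]
theorem legWeightSum_cons (y : ℕ) (s : Multiset ℕ) :
    legWeightSum β c (y ::ₘ s) = legWeight β c y + legWeightSum β c s := by
  simp [legWeightSum]

@[simp]
theorem legWeightSum_add (s t : Multiset ℕ) :
    legWeightSum β c (s + t) = legWeightSum β c s + legWeightSum β c t := by
  simp [legWeightSum]

@[simp]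
theorem legWeightSum_replicate (k y : ℕ) :
    legWeightSum β c (Multiset.replicate k y) = k * legWeight β c y := by
  simp [legWeightSum]

theorem legWeightSum_coe (a : List ℕ) :
    legWeightSum β c a = ∑ i : Fin a.length, legWeight β c (a.get i) := by
  simp [legWeightSum, ← Fin.sum_univ_fun_getElem]

theorem legWeightSum_nonneg (hβ : 0 ≤ β) {s : Multiset ℕ} (hs : ∀ y ∈ s, LegValid β c y) :
    0 ≤ legWeightSum β c s :=
  Multiset.sum_nonneg (Multiset.forall_mem_map_iff.2 fun y hy => (hs y hy).legWeight_nonneg hβ)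

theorem legWeight_le_legWeightSum (hβ : 0 ≤ β) {s : Multiset ℕ} (hs : ∀ y ∈ s, LegValid β c y)
    {y : ℕ} (hy : y ∈ s) : legWeight β c y ≤ legWeightSum β c s := by
  obtain ⟨t, rfl⟩ := Multiset.exists_cons_of_mem hy
  rw [legWeightSum_cons]
  exact le_add_of_nonneg_right
    (legWeightSum_nonneg hβ fun z hz => hs z (Multiset.mem_cons_of_mem hz))

theorem legWeightSum_le_card_mul (hβ : 0 ≤ β) {s : Multiset ℕ} {w : ℕ} (hw : LegValid β c w)
    (hs : ∀ y ∈ s, y ≤ w) : legWeightSum β c s ≤ s.card * legWeight β c w := by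
  simpa only [legWeightSum, Multiset.card_map, nsmul_eq_mul] using
    Multiset.sum_le_card_nsmul (s.map (legWeight β c)) _
      (Multiset.forall_mem_map_iff.2 fun y hy => hw.legWeight_le hβ (hs y hy) le_rfl)

theorem card_mul_le_legWeightSum (hβ : 0 ≤ β) {s : Multiset ℕ} {x : ℕ}
    (hs : ∀ y ∈ s, x ≤ y) (hvs : ∀ y ∈ s, LegValid β c y) :
    s.card * legWeight β c x ≤ legWeightSum β c s := by
  simpa only [legWeightSum, Multiset.card_map, nsmul_eq_mul] using
    Multiset.card_nsmul_le_sum (s := s.map (legWeight β c))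
      (Multiset.forall_mem_map_iff.2 fun y hy => (hvs y hy).legWeight_le hβ (hs y hy) le_rfl)

theorem legWeightSum_cons_lt_card_mul (hβ : 0 ≤ β) {x w : ℕ} {s : Multiset ℕ} (hxw : x < w)
    (hw : LegValid β c w) (hs : ∀ y ∈ s, y ≤ w)
    (hsum : legWeightSum β c (w ::ₘ x ::ₘ s) ≤ c + 2 * β) :
    legWeightSum β c (x ::ₘ s) < (x ::ₘ s).card * legWeight β c (x + 1) := by
  have hx : LegValid β c (x + 1) := hw.mono hxw
  have hsw := legWeightSum_le_card_mul hβ hw hs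
  simp only [legWeightSum_cons, Multiset.card_cons, Nat.cast_add_one] at hsum ⊢
  rcases s.card.eq_zero_or_pos with h0 | hpos
  · have hlt := hx.strictMonoOn_legWeight hβ (Set.mem_Iic.2 x.le_succ) (Set.mem_Iic.2 le_rfl)
      x.lt_succ_self
    simp only [h0, Nat.cast_zero] at hsw ⊢
    linarith
  · rcases le_or_gt ((s.card + 1) * legRatio β c (x + 1)
        + ((s.card + 1) * legRatio β c (x + 1))⁻¹) c with hc | hc
    · exact (add_le_add_right hsw _).trans_lt
        (legWeight_add_mul_lt_of_add_inv_le hβ w hpos hx hc)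
    · exact legWeight_add_lt_of_lt_add_inv hβ hx hc hsw (by linarith)

theorem exists_eq_cons_forall_le {s : Multiset ℕ} (hs : s ≠ 0) :
    ∃ w t, s = w ::ₘ t ∧ ∀ y ∈ t, y ≤ w := by
  obtain ⟨w, hw, hmax⟩ := Multiset.exists_max_image id hs
  obtain ⟨t, rfl⟩ := Multiset.exists_cons_of_mem hw
  exact ⟨w, t, rfl, fun y hy => hmax y (Multiset.mem_cons_of_mem hy)⟩

theorem eq_of_sum_eq_of_forall_le {s t : Multiset ℕ} {k : ℕ} (hcard : s.card = t.card)
    (hsum : s.sum = t.sum) (hs : ∀ y ∈ s, k ≤ y) (ht : ∀ y ∈ t, y ≤ k) : s = t := by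
  induction t using Multiset.induction generalizing s with
  | empty => exact Multiset.card_eq_zero.1 hcard
  | cons y t ih =>
    obtain ⟨z, hz⟩ : ∃ z, z ∈ s := by
      rw [← Multiset.card_pos_iff_exists_mem, hcard, Multiset.card_cons]
      exact Nat.succ_pos _
    obtain ⟨s, rfl⟩ := Multiset.exists_cons_of_mem hz
    rw [Multiset.forall_mem_cons] at hs ht
    rw [Multiset.card_cons, Multiset.card_cons, add_left_inj] at hcard
    rw [Multiset.sum_cons, Multiset.sum_cons] at hsum
    have hs_sum : s.card * k ≤ s.sum := Multiset.card_nsmul_le_sum hs.2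
    have ht_sum : t.sum ≤ t.card * k := Multiset.sum_le_card_nsmul t k ht.2
    rw [hcard] at hs_sum
    obtain rfl : z = y := by omega
    rw [ih hcard (by omega) hs.2 ht.2]

theorem legWeightSum_lt_of_forall_lt (hβ : 0 ≤ β) {x w : ℕ} {s t : Multiset ℕ} (hxw : x < w)
    (hw : LegValid β c w) (hcard : s.card = t.card) (hxs : x ∈ s) (hsw : ∀ y ∈ s, y ≤ w)
    (hbound : legWeightSum β c (w ::ₘ s) ≤ c + 2 * β) (ht : ∀ y ∈ t, x < y)
    (hvt : ∀ y ∈ t, LegValid β c y) : legWeightSum β c s < legWeightSum β c t := by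
  obtain ⟨s, rfl⟩ := Multiset.exists_cons_of_mem hxs
  calc legWeightSum β c (x ::ₘ s) < (x ::ₘ s).card * legWeight β c (x + 1) :=
        legWeightSum_cons_lt_card_mul hβ hxw hw
          (fun y hy => hsw y (Multiset.mem_cons_of_mem hy)) hbound
    _ = t.card * legWeight β c (x + 1) := by rw [hcard]
    _ ≤ legWeightSum β c t := card_mul_le_legWeightSum hβ ht hvt

theorem legWeightSum_le_of_forall_le_succ (hβ : 0 ≤ β) {x w : ℕ} {s t : Multiset ℕ} (hxw : x < w)
    (hw : LegValid β c w) (hcard : s.card = t.card) (hsum : s.sum = t.sum)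
    (hsx : ∀ y ∈ s, x ≤ y) (hsw : ∀ y ∈ s, y ≤ w)
    (hbound : legWeightSum β c (w ::ₘ s) ≤ c + 2 * β) (ht : ∀ y ∈ t, x ≤ y ∧ y ≤ x + 1) :
    legWeightSum β c s ≤ legWeightSum β c t := by
  induction hk : t.card generalizing s t with
  | zero => rw [Multiset.card_eq_zero.1 hk, Multiset.card_eq_zero.1 (hcard.trans hk)]
  | succ k ih =>
    by_cases hxs : x ∈ s
    · by_cases hxt : x ∈ t
      · obtain ⟨s, rfl⟩ := Multiset.exists_cons_of_mem hxs
        obtain ⟨t, rfl⟩ := Multiset.exists_cons_of_mem hxt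
        simp only [Multiset.card_cons, Multiset.sum_cons, legWeightSum_cons,
          Multiset.forall_mem_cons] at *
        have hx0 := (hw.mono hxw.le).legWeight_nonneg hβ
        exact add_le_add_right
          (ih (by omega) (by omega) hsx.2 hsw.2 (by linarith) ht.2 (by omega)) _
      · have ht' : ∀ y ∈ t, x < y := fun y hy => (ht y hy).1.lt_of_ne fun h => hxt (h ▸ hy)
        exact (legWeightSum_lt_of_forall_lt hβ hxw hw hcard hxs hsw hbound ht'
          fun y hy => hw.mono ((ht y hy).2.trans hxw)).le
    · rw [eq_of_sum_eq_of_forall_le hcard hsum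
        (fun y hy => (hsx y hy).lt_of_ne fun h => hxs (h ▸ hy)) fun y hy => (ht y hy).2]

/-- The condition on the entries of a multiset that is preserved when its largest entry is lowered
by one, as long as this entry is not `x`. -/
def HasFloor (x : ℕ) (s : Multiset ℕ) : Prop :=
  (∀ y ∈ s, x < y) ∨ ∀ y ∈ s, x ≤ y ∧ y ≤ x + 1

theorem HasFloor.cons_of_succ {x y : ℕ} {s : Multiset ℕ} (h : HasFloor x ((y + 1) ::ₘ s))
    (hs : ∀ z ∈ s, z ≤ y + 1) (hxy : x ≤ y) : HasFloor x (y ::ₘ s) := by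
  simp only [HasFloor, Multiset.forall_mem_cons] at h ⊢
  rcases hxy.eq_or_lt with rfl | hlt
  · exact Or.inr ⟨by omega, fun z hz =>
      ⟨h.elim (fun h => (h.2 z hz).le) fun h => (h.2 z hz).1, hs z hz⟩⟩
  · exact Or.inl ⟨hlt, (h.resolve_right fun h => by omega).2⟩

theorem exists_legWeightSum_succ_cons_lt (hβ : 0 ≤ β) {x v w : ℕ} {s t : Multiset ℕ}
    (hcard : s.card = t.card) (hsum : w + s.sum = v + t.sum) (hvw : v < w)
    (hs : ∀ y ∈ s, x ≤ y) (ht : HasFloor x t) (hv : LegValid β c v) (htv : ∀ y ∈ t, y ≤ v)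
    (hslack : ∀ y ∈ t, legWeight β c y + legWeight β c v < c + 2 * β) :
    ∃ t', t'.card = t.card ∧ v + 1 + t'.sum = v + t.sum ∧ HasFloor x t' ∧ (∀ y ∈ t', y ≤ v) ∧
      LegValid β c (v + 1) ∧ legWeightSum β c ((v + 1) ::ₘ t') < legWeightSum β c (v ::ₘ t) := by
  have hs_sum : s.card * x ≤ s.sum := Multiset.card_nsmul_le_sum hs
  have ht0 : t ≠ 0 := by
    rintro rfl
    rw [Multiset.card_zero, Multiset.card_eq_zero] at hcard
    rw [hcard, Multiset.sum_zero] at hsum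
    omega
  obtain ⟨y, t, rfl, hty⟩ := exists_eq_cons_forall_le ht0
  have hxy : x < y := by
    by_contra! hyx
    have ht_sum : (y ::ₘ t).sum ≤ (y ::ₘ t).card * x := Multiset.sum_le_card_nsmul _ _
      (Multiset.forall_mem_cons.2 ⟨hyx, fun z hz => (hty z hz).trans hyx⟩)
    rw [hcard] at hs_sum
    omega
  obtain ⟨y, rfl⟩ := Nat.exists_eq_succ_of_ne_zero hxy.ne_bot
  rw [Multiset.forall_mem_cons] at htv hslack
  have hmove := hv.legWeight_add_legWeight_succ_lt hβ htv.1 hslack.1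
  refine ⟨y ::ₘ t, by simp, by simp only [Multiset.sum_cons]; omega,
    ht.cons_of_succ hty (Nat.lt_succ_iff.1 hxy),
    Multiset.forall_mem_cons.2 ⟨by omega, htv.2⟩, hv.succ_of_add_lt htv.1 hslack.1, ?_⟩
  simp only [legWeightSum_cons]
  linarith

theorem legWeightSum_cons_le_of_hasFloor (hβ : 0 ≤ β) {x v w : ℕ} {s t : Multiset ℕ} (hxw : x < w)
    (hw : LegValid β c w) (hcard : s.card = t.card) (hsum : w + s.sum = v + t.sum) (hvw : v ≤ w)
    (hxs : x ∈ s) (hsx : ∀ y ∈ s, x ≤ y) (hsw : ∀ y ∈ s, y ≤ w)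
    (hbound : legWeightSum β c (w ::ₘ s) ≤ c + 2 * β)
    (ht : HasFloor x t) (hv : LegValid β c v) (htv : ∀ y ∈ t, y ≤ v)
    (hbound' : legWeightSum β c (v ::ₘ t) < c + 2 * β) :
    legWeightSum β c (w ::ₘ s) ≤ legWeightSum β c (v ::ₘ t) := by
  induction hd : w - v generalizing v t with
  | zero =>
    obtain rfl : v = w := by omega
    simp only [legWeightSum_cons (s := s), legWeightSum_cons (s := t)]
    refine add_le_add_right (ht.elim (fun ht => ?_) fun ht => ?_) _
    · exact (legWeightSum_lt_of_forall_lt hβ hxw hw hcard hxs hsw hbound ht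
        fun y hy => hv.mono (htv y hy)).le
    · exact legWeightSum_le_of_forall_le_succ hβ hxw hw hcard (by omega) hsx hsw hbound ht
  | succ d ih =>
    have hslack : ∀ y ∈ t, legWeight β c y + legWeight β c v < c + 2 * β := fun y hy => by
      have := legWeight_le_legWeightSum hβ (fun z hz => hv.mono (htv z hz)) hy
      rw [legWeightSum_cons] at hbound'
      linarith
    obtain ⟨t', hcard', hsum', ht', htv', hv', hlt⟩ :=
      exists_legWeightSum_succ_cons_lt hβ hcard hsum (by omega) hsx ht hv htv hslack
    exact (ih (by omega) (by omega) (by omega) ht' hv' (fun y hy => (htv' y hy).trans v.le_succ)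
      (hlt.trans hbound') (by omega)).trans hlt.le

theorem legWeightSum_lt_of_mem_of_forall_lt (hβ : 0 ≤ β) {x : ℕ} {s t : Multiset ℕ}
    (hcard : s.card = t.card) (hsum : s.sum = t.sum) (hxs : x ∈ s) (hsx : ∀ y ∈ s, x ≤ y)
    (htx : ∀ y ∈ t, x < y) (hvs : ∀ y ∈ s, LegValid β c y) (hvt : ∀ y ∈ t, LegValid β c y)
    (hbound_s : legWeightSum β c s ≤ c + 2 * β) (hbound_t : legWeightSum β c t ≤ c + 2 * β)
    (hslack : ∀ y v t', t = y ::ₘ v ::ₘ t' → legWeight β c y + legWeight β c v < c + 2 * β) :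
    legWeightSum β c s < legWeightSum β c t := by
  have hs0 : 0 < s.card := Multiset.card_pos_iff_exists_mem.2 ⟨x, hxs⟩
  have htsum : t.card * (x + 1) ≤ t.sum := Multiset.card_nsmul_le_sum htx
  obtain ⟨w, s, rfl, hsw⟩ := exists_eq_cons_forall_le (Multiset.card_pos.1 hs0)
  obtain ⟨v, t, rfl, htv⟩ := exists_eq_cons_forall_le (Multiset.card_pos.1 (hcard ▸ hs0))
  have hxw : x < w := by
    by_contra! hwx
    have hssum : (w ::ₘ s).sum ≤ (w ::ₘ s).card * x := Multiset.sum_le_card_nsmul _ _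
      (Multiset.forall_mem_cons.2 ⟨hwx, fun z hz => (hsw z hz).trans hwx⟩)
    rw [← hcard, mul_add_one] at htsum
    omega
  have hxs' : x ∈ s := (Multiset.mem_cons.1 hxs).resolve_left hxw.ne
  rw [Multiset.card_cons, Multiset.card_cons, add_left_inj] at hcard
  rw [Multiset.sum_cons, Multiset.sum_cons] at hsum
  rw [Multiset.forall_mem_cons] at hvs hsx htx hvt
  rcases lt_or_ge v w with hvw | hwv
  · obtain ⟨t', hcard', hsum', ht', htv', hv', hlt⟩ :=
      exists_legWeightSum_succ_cons_lt hβ hcard hsum hvw hsx.2 (Or.inl htx.2) hvt.1 htv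
        fun y hy => by
          obtain ⟨t', rfl⟩ := Multiset.exists_cons_of_mem hy
          exact hslack y v t' (Multiset.cons_swap v y t')
    exact (legWeightSum_cons_le_of_hasFloor hβ hxw hvs.1 (by omega) (by omega) hvw hxs' hsx.2 hsw
      hbound_s ht' hv' (fun y hy => (htv' y hy).trans v.le_succ) (hlt.trans_le hbound_t)).trans_lt
      hlt
  · rw [legWeightSum_cons w, legWeightSum_cons v]
    exact add_lt_add_of_le_of_lt (hvt.1.legWeight_le hβ hwv le_rfl)
      (legWeightSum_lt_of_forall_lt hβ hxw hvs.1 hcard hxs' hsw hbound_s htx.2 hvt.2)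

theorem legWeight_add_legWeight_lt (hβ : 0 ≤ β) {y v : ℕ} {s t : Multiset ℕ}
    (ht : t = y ::ₘ v ::ₘ s) (ht0 : ∀ z ∈ t, 0 < z) (hvt : ∀ z ∈ t, LegValid β c z)
    (hbound : legWeightSum β c t ≤ c + 2 * β)
    (hstrict : t.card = 2 → legWeightSum β c t < c + 2 * β) :
    legWeight β c y + legWeight β c v < c + 2 * β := by
  subst ht
  simp only [Multiset.forall_mem_cons, legWeightSum_cons, Multiset.card_cons] at *
  rcases s.empty_or_exists_mem with rfl | ⟨z, hz⟩
  · simpa [legWeightSum] using hstrict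
  · linarith [(hvt.2.2 z hz).legWeight_pos hβ (ht0.2.2 z hz),
      legWeight_le_legWeightSum hβ hvt.2.2 hz]

end LegWeightSum

section Shortlex

theorem exists_common_part_of_lex {a b : List ℕ} (hab : List.Lex (· < ·) a b)
    (ha : a.Pairwise (· ≤ ·)) (hb : b.Pairwise (· ≤ ·)) (hlen : a.length = b.length) :
    ∃ (x : ℕ) (C A B : Multiset ℕ), (a : Multiset ℕ) = C + A ∧ (b : Multiset ℕ) = C + B ∧
      A.card = B.card ∧ x ∈ A ∧ (∀ y ∈ A, x ≤ y) ∧ ∀ y ∈ B, x < y := by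
  induction hab with
  | nil => exact absurd hlen (Nat.succ_ne_zero _).symm
  | @rel x a y b hxy =>
    refine ⟨x, 0, ↑(x :: a), ↑(y :: b), (zero_add _).symm, (zero_add _).symm, hlen, by simp, ?_, ?_⟩
    · exact List.forall_mem_cons.2 ⟨le_rfl, fun z hz => List.rel_of_pairwise_cons ha hz⟩
    · exact List.forall_mem_cons.2 ⟨hxy, fun z hz => hxy.trans_le (List.rel_of_pairwise_cons hb hz)⟩
  | @cons z a b _ ih =>
    obtain ⟨x, C, A, B, hCA, hCB, h⟩ := ih ha.of_cons hb.of_cons (Nat.succ_injective hlen)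
    refine ⟨x, z ::ₘ C, A, B, ?_, ?_, h⟩
    · rw [← Multiset.cons_coe, hCA, Multiset.cons_add]
    · rw [← Multiset.cons_coe, hCB, Multiset.cons_add]

theorem length_le_of_shortlex {a b : List ℕ} (hab : List.Shortlex (· < ·) a b) :
    a.length ≤ b.length :=
  (List.shortlex_def.1 hab).elim le_of_lt fun h => h.1.le

variable {n : ℕ} {a b : List ℕ}

theorem IsPartition.exists_common_part (ha : IsPartition n a) (hb : IsPartition n b)
    (hab : List.Shortlex (· < ·) a b) :
    ∃ (k x : ℕ) (C A B : Multiset ℕ), (a : Multiset ℕ) + Multiset.replicate k 0 = C + A ∧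
      (b : Multiset ℕ) = C + B ∧ A.card = B.card ∧ x ∈ A ∧ (∀ y ∈ A, x ≤ y) ∧ ∀ y ∈ B, x < y := by
  rcases List.shortlex_def.1 hab with hlt | ⟨hlen, hlex⟩
  · refine ⟨b.length - a.length, 0, 0, _, b, (zero_add _).symm, (zero_add _).symm, ?_, ?_,
      fun _ _ => Nat.zero_le _, hb.2.1⟩
    · rw [Multiset.card_add, Multiset.card_replicate, Multiset.coe_card, Multiset.coe_card]
      omega
    · exact Multiset.mem_add.2 (Or.inr (Multiset.mem_replicate.2 ⟨by omega, rfl⟩))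
  · obtain ⟨x, C, A, B, hCA, h⟩ := exists_common_part_of_lex hlex ha.1 hb.1 hlen
    exact ⟨0, x, C, A, B, by rw [Multiset.replicate_zero, add_zero, hCA], h⟩

theorem IsPartition.legWeightSum_lt {β c : ℝ} (hβ : 0 ≤ β) (ha : IsPartition n a)
    (hb : IsPartition n b) (hab : List.Shortlex (· < ·) a b) (hva : ∀ k ∈ a, LegValid β c k)
    (hvb : ∀ k ∈ b, LegValid β c k) (hbound_a : legWeightSum β c a ≤ c + 2 * β)
    (hbound_b : legWeightSum β c b ≤ c + 2 * β)
    (hstrict : b.length = 2 → legWeightSum β c b < c + 2 * β) :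
    legWeightSum β c a < legWeightSum β c b := by
  obtain ⟨k, x, C, A, B, hCA, hCB, hcard, hxA, hA, hB⟩ := ha.exists_common_part hb hab
  have hFa : legWeightSum β c a = legWeightSum β c C + legWeightSum β c A := by
    rw [← legWeightSum_add, ← hCA, legWeightSum_add, legWeightSum_replicate, legWeight_zero,
      mul_zero, add_zero]
  have hsum : A.sum = B.sum := by
    refine Nat.add_left_cancel (n := C.sum) ?_
    rw [← Multiset.sum_add, ← Multiset.sum_add, ← hCA, ← hCB, Multiset.sum_add,
      Multiset.sum_replicate, smul_zero, add_zero, Multiset.sum_coe, Multiset.sum_coe, ha.2.2,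
      hb.2.2]
  have hvA : ∀ y ∈ A, LegValid β c y := fun y hy => by
    rcases Multiset.mem_add.1 (hCA ▸ Multiset.mem_add.2 (Or.inr hy)) with hy | hy
    · exact hva y hy
    · exact Multiset.eq_of_mem_replicate hy ▸ legValid_zero
  have hvCB : ∀ y ∈ C + B, LegValid β c y := by rwa [← hCB]
  have hFC := legWeightSum_nonneg hβ fun y hy => hvCB y (Multiset.mem_add.2 (Or.inl hy))
  have hFb : legWeightSum β c b = legWeightSum β c C + legWeightSum β c B := by
    rw [hCB, legWeightSum_add]
  have hlt : legWeightSum β c A < legWeightSum β c B := by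
    refine legWeightSum_lt_of_mem_of_forall_lt hβ hcard hsum hxA hA hB hvA
      (fun y hy => hvCB y (Multiset.mem_add.2 (Or.inr hy))) (by linarith) (by linarith) ?_
    rintro y v t rfl
    exact legWeight_add_legWeight_lt (s := C + t) hβ
      (by rw [hCB, Multiset.add_cons, Multiset.add_cons])
      hb.2.1 hvb hbound_b hstrict
  linarith

end Shortlex

section SymmetricMatrix

open Matrix

variable {ι : Type*} [Fintype ι] {A : Matrix ι ι ℝ} {ρ : ℝ}

theorem posSemidef_smul_one_sub [DecidableEq ι] (hA : A.IsHermitian)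
    (hρ : ∀ μ ∈ spectrum ℝ A, μ ≤ ρ) : (ρ • (1 : Matrix ι ι ℝ) - A).PosSemidef := by
  refine posSemidef_iff_isHermitian_and_spectrum_nonneg.2
    ⟨(isHermitian_one.smul (IsSelfAdjoint.all ρ)).sub hA, fun ν hν => ?_⟩
  rw [← Algebra.algebraMap_eq_smul_one, ← spectrum.singleton_sub_eq, Set.singleton_sub] at hν
  obtain ⟨μ, hμ, rfl⟩ := hν
  exact sub_nonneg.2 (hρ μ hμ)

theorem dotProduct_mulVec_le_abs (hA0 : ∀ i j, 0 ≤ A i j) (y : ι → ℝ) :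
    y ⬝ᵥ A *ᵥ y ≤ |y| ⬝ᵥ A *ᵥ |y| := by
  simp only [dotProduct, mulVec, Finset.mul_sum, Pi.abs_apply]
  refine Finset.sum_le_sum fun i _ => Finset.sum_le_sum fun j _ => ?_
  calc y i * (A i j * y j) = A i j * (y i * y j) := mul_left_comm _ _ _
    _ ≤ A i j * |y i * y j| := mul_le_mul_of_nonneg_left (le_abs_self _) (hA0 i j)
    _ = |y i| * (A i j * |y j|) := by rw [abs_mul, mul_left_comm]

-- `|y|` also attains the maximum `ρ` of the Rayleigh quotient.
theorem mulVec_abs_eq_of_mulVec_eq [DecidableEq ι] (hA : A.IsHermitian) (hA0 : ∀ i j, 0 ≤ A i j)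
    (hρ : ∀ μ ∈ spectrum ℝ A, μ ≤ ρ) {y : ι → ℝ} (hy : A *ᵥ y = ρ • y) :
    A *ᵥ |y| = ρ • |y| := by
  have hP := posSemidef_smul_one_sub hA hρ
  have hmul : (ρ • (1 : Matrix ι ι ℝ) - A) *ᵥ |y| = ρ • |y| - A *ᵥ |y| := by
    rw [sub_mulVec, smul_mulVec, one_mulVec]
  have hnorm : |y| ⬝ᵥ |y| = y ⬝ᵥ y := by
    simp only [dotProduct, Pi.abs_apply, abs_mul_abs_self]
  have hzero : |y| ⬝ᵥ (ρ • (1 : Matrix ι ι ℝ) - A) *ᵥ |y| = 0 := by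
    refine le_antisymm ?_ (hP.dotProduct_mulVec_nonneg |y|)
    calc |y| ⬝ᵥ (ρ • (1 : Matrix ι ι ℝ) - A) *ᵥ |y| = ρ • (y ⬝ᵥ y) - |y| ⬝ᵥ A *ᵥ |y| := by
          rw [hmul, dotProduct_sub, dotProduct_smul, hnorm]
      _ ≤ ρ • (y ⬝ᵥ y) - y ⬝ᵥ A *ᵥ y := sub_le_sub_left (dotProduct_mulVec_le_abs hA0 y) _
      _ = 0 := by rw [hy, dotProduct_smul, sub_self]
  exact (sub_eq_zero.1 (hmul ▸ (hP.dotProduct_mulVec_zero_iff |y|).1 hzero)).symm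

theorem le_of_subsolution_of_supersolution [DecidableEq ι] (hA : A.IsHermitian) {u : ι}
    {p q : ℝ} {x z : ι → ℝ} (hx : ∀ i, 0 < x i) (hz : ∀ i, 0 < z i)
    (hsub : ρ • x ≤ A *ᵥ x + Pi.single u (p * x u))
    (hsuper : A *ᵥ z + Pi.single u (q * z u) ≤ ρ • z) : q ≤ p := by
  have hsymm : x ⬝ᵥ A *ᵥ z = z ⬝ᵥ A *ᵥ x := by
    rw [dotProduct_mulVec, ← mulVec_transpose, ← conjTranspose_eq_transpose_of_trivial, hA.eq,
      dotProduct_comm]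
  have hsub' : z ⬝ᵥ (ρ • x) ≤ z ⬝ᵥ (A *ᵥ x + Pi.single u (p * x u)) :=
    dotProduct_le_dotProduct_of_nonneg_left hsub fun i => (hz i).le
  have hsuper' : x ⬝ᵥ (A *ᵥ z + Pi.single u (q * z u)) ≤ x ⬝ᵥ (ρ • z) :=
    dotProduct_le_dotProduct_of_nonneg_left hsuper fun i => (hx i).le
  rw [dotProduct_add, dotProduct_single, dotProduct_smul] at hsub' hsuper'
  rw [hsymm] at hsuper'
  rw [dotProduct_comm z x] at hsub'
  refine le_of_mul_le_mul_left ?_ (mul_pos (hx u) (hz u))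
  linarith

end SymmetricMatrix

section AlphaMatrix

open Matrix

variable {V : Type*} [Fintype V] {G : SimpleGraph V} {α : ℝ}

open Classical in
theorem alphaMatrix_mulVec_apply (G : SimpleGraph V) (α : ℝ) (x : V → ℝ) (v : V) :
    (alphaMatrix G α *ᵥ x) v = ∑ w, if G.Adj v w then α * x v + (1 - α) * x w else 0 := by
  simp only [alphaMatrix, add_mulVec, smul_mulVec, Pi.add_apply, Pi.smul_apply,
    SimpleGraph.degMatrix_mulVec_apply, SimpleGraph.adjMatrix_mulVec_apply, smul_eq_mul,
    ← Finset.sum_filter, Finset.sum_add_distrib, Finset.sum_const, nsmul_eq_mul, Finset.mul_sum,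
    SimpleGraph.neighborFinset_eq_filter, ← SimpleGraph.card_neighborFinset_eq_degree]
  ring

theorem alphaMatrix_apply_nonneg (hα0 : 0 ≤ α) (hα1 : α ≤ 1) (v w : V) :
    0 ≤ alphaMatrix G α v w := by
  classical
  have : 0 ≤ 1 - α := sub_nonneg.2 hα1
  simp only [alphaMatrix, SimpleGraph.degMatrix, Matrix.add_apply, Matrix.smul_apply,
    diagonal_apply, SimpleGraph.adjMatrix_apply, smul_eq_mul]
  split_ifs <;> positivity

theorem alphaMatrix_mulVec_nonneg (hα0 : 0 ≤ α) (hα1 : α ≤ 1) {x : V → ℝ} (hx : ∀ v, 0 ≤ x v)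
    (v : V) : 0 ≤ (alphaMatrix G α *ᵥ x) v :=
  Finset.sum_nonneg fun w _ => mul_nonneg (alphaMatrix_apply_nonneg hα0 hα1 v w) (hx w)

theorem alphaMatrix_mulVec_pos (hα0 : 0 ≤ α) (hα1 : α < 1) {x : V → ℝ} (hx : ∀ v, 0 ≤ x v)
    {v w : V} (hvw : G.Adj v w) (hw : 0 < x w) : 0 < (alphaMatrix G α *ᵥ x) v := by
  classical
  have : 0 < 1 - α := sub_pos.2 hα1
  rw [alphaMatrix_mulVec_apply]
  refine Finset.sum_pos' (fun w _ => ?_) ⟨w, Finset.mem_univ w, ?_⟩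
  · have := hx v
    have := hx w
    positivity
  · have := hx v
    rw [if_pos hvw]
    positivity

theorem pos_of_alphaMatrix_mulVec_eq (hG : G.Connected) (hα0 : 0 ≤ α) (hα1 : α < 1) {ρ : ℝ}
    {x : V → ℝ} (hx : ∀ v, 0 ≤ x v) (hx0 : x ≠ 0) (hAx : alphaMatrix G α *ᵥ x = ρ • x) (v : V) :
    0 < x v := by
  obtain ⟨w, hw⟩ := Function.ne_iff.1 hx0
  obtain ⟨p⟩ := hG.preconnected v w
  induction p with
  | nil => exact (hx _).lt_of_ne' hw
  | @cons v w _ hvw _ ih =>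
    refine (hx v).lt_of_ne' fun hv => ?_
    have := alphaMatrix_mulVec_pos hα0 hα1 hx hvw (ih hw)
    rw [hAx, Pi.smul_apply, hv, smul_zero] at this
    exact this.false

theorem exists_pos_alphaMatrix_mulVec_eq (hG : G.Connected) (hα0 : 0 ≤ α) (hα1 : α < 1) :
    ∃ x : V → ℝ, (∀ v, 0 < x v) ∧ alphaMatrix G α *ᵥ x = rhoAlpha α G • x := by
  classical
  have := hG.nonempty
  obtain ⟨hmem, hmax⟩ := isGreatest_rhoAlpha α G
  rw [← spectrum_toLin', ← Module.End.hasEigenvalue_iff_mem_spectrum] at hmem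
  obtain ⟨y, hy⟩ := hmem.exists_hasEigenvector
  have hAy : alphaMatrix G α *ᵥ y = rhoAlpha α G • y := by
    simpa only [toLin'_apply] using hy.apply_eq_smul
  have hAx := mulVec_abs_eq_of_mulVec_eq (alphaMatrix_isHermitian G α)
    (alphaMatrix_apply_nonneg hα0 hα1.le) hmax hAy
  exact ⟨|y|, pos_of_alphaMatrix_mulVec_eq hG hα0 hα1 (fun v => abs_nonneg (y v))
    (fun h => hy.2 (funext fun v => abs_eq_zero.1 (congrFun h v))) hAx, hAx⟩

theorem alphaMatrix_eq_reindex_of_iso {W : Type*} [Fintype W] {H : SimpleGraph W} (e : G ≃g H)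
    (α : ℝ) : alphaMatrix H α = reindex e.toEquiv e.toEquiv (alphaMatrix G α) := by
  classical
  ext v w
  have hadj : G.Adj (e.toEquiv.symm v) (e.toEquiv.symm w) ↔ H.Adj v w := e.symm.map_adj_iff
  have hdeg : G.degree (e.toEquiv.symm v) = H.degree v := e.symm.degree_eq v
  simp only [alphaMatrix, SimpleGraph.degMatrix, reindex_apply, submatrix_apply, Matrix.add_apply,
    Matrix.smul_apply, diagonal_apply, SimpleGraph.adjMatrix_apply, hadj, hdeg,
    EmbeddingLike.apply_eq_iff_eq]

theorem rhoAlpha_eq_of_iso {W : Type*} [Fintype W] {H : SimpleGraph W} (e : G ≃g H) (α : ℝ) :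
    rhoAlpha α G = rhoAlpha α H := by
  classical
  rw [rhoAlpha, rhoAlpha, alphaMatrix_eq_reindex_of_iso e, ← coe_reindexAlgEquiv ℝ ℝ,
    AlgEquiv.spectrum_eq]

end AlphaMatrix

section LegSolution

variable {β c : ℝ} {N : ℕ} {Z : ℕ → ℝ}

theorem legValid_of_supersolution (hZ : ∀ s ≤ N, 0 < Z s) (h0 : 0 < N → Z 1 ≤ (c + β) * Z 0)
    (h : ∀ s, s + 2 ≤ N → Z s + Z (s + 2) ≤ c * Z (s + 1)) :
    LegValid β c N ∧ ∀ s < N, legRatio β c (s + 1) * Z (s + 1) ≤ Z s := by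
  have hstep : ∀ s < N, Z (s + 1) ≤ (c - legRatio β c s) * Z s →
      0 < c - legRatio β c s ∧ legRatio β c (s + 1) * Z (s + 1) ≤ Z s := fun s hs hle => by
    have hden := pos_of_mul_pos_left ((hZ _ hs).trans_le hle) (hZ s hs.le).le
    exact ⟨hden, by rwa [legRatio_succ, inv_mul_le_iff₀ hden]⟩
  have hle : ∀ s < N, Z (s + 1) ≤ (c - legRatio β c s) * Z s := fun s hs => by
    induction s with
    | zero => simpa only [legRatio_zero, sub_neg_eq_add] using h0 hs
    | succ s ih =>
      have hs' : s < N := s.lt_succ_self.trans hs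
      linarith [h s hs, (hstep s hs' (ih hs')).2]
  exact ⟨fun s hs => sub_pos.1 (hstep s hs (hle s hs)).1, fun s hs => (hstep s hs (hle s hs)).2⟩

theorem LegValid.le_legRatio_mul_of_subsolution (hN : LegValid β c N)
    (h0 : 0 < N → (c + β) * Z 0 ≤ Z 1)
    (h : ∀ s, s + 2 ≤ N → c * Z (s + 1) ≤ Z s + Z (s + 2)) {s : ℕ} (hs : s < N) :
    Z s ≤ legRatio β c (s + 1) * Z (s + 1) := by
  rw [legRatio_succ, le_inv_mul_iff₀ (sub_pos.2 (hN s hs))]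
  induction s with
  | zero => simpa only [legRatio_zero, sub_neg_eq_add] using h0 hs
  | succ s ih =>
    have hs' : s < N := s.lt_succ_self.trans hs
    have := ih hs'
    rw [← le_inv_mul_iff₀ (sub_pos.2 (hN s hs')), ← legRatio_succ] at this
    linarith [h s hs]

end LegSolution

section AttachPaths

open Matrix

variable {V : Type*} {G : SimpleGraph V} {u : V} {a : List ℕ} {α : ℝ}

theorem attachPaths_connected (hG : G.Connected) (u : V) (a : List ℕ) :
    (attachPaths G u a).Connected := by
  let f : G →g attachPaths G u a := ⟨Sum.inl, fun h => h⟩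
  rw [SimpleGraph.connected_iff_exists_forall_reachable]
  refine ⟨Sum.inl u, ?_⟩
  rintro (v | ⟨i, j, hj⟩)
  · exact (hG.preconnected u v).map f
  · induction j with
    | zero =>
      have hadj : (attachPaths G u a).Adj (Sum.inl u) (Sum.inr ⟨i, 0, hj⟩) := ⟨rfl, rfl⟩
      exact hadj.reachable
    | succ j ih =>
      have hj' : j < a.get i := j.lt_succ_self.trans hj
      have hadj : (attachPaths G u a).Adj (Sum.inr ⟨i, j, hj'⟩) (Sum.inr ⟨i, j + 1, hj⟩) :=
        ⟨rfl, Or.inl rfl⟩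
      exact (ih hj').trans hadj.reachable

/-- The values of a vector on `G(a, u)` along the `i`-th pendant path, read from the free end; the
value at the root `u` is repeated from index `a.get i` on. -/
def legValue (x : AttachVert V a → ℝ) (u : V) (i : Fin a.length) (s : ℕ) : ℝ :=
  if h : s < a.get i then x (Sum.inr ⟨i, Fin.rev ⟨s, h⟩⟩) else x (Sum.inl u)

theorem legValue_length (x : AttachVert V a → ℝ) (u : V) (i : Fin a.length) :
    legValue x u i (a.get i) = x (Sum.inl u) :=
  dif_neg (lt_irrefl _)

theorem legValue_of_lt (x : AttachVert V a → ℝ) (u : V) (i : Fin a.length) {s : ℕ}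
    (hs : s < a.get i) : legValue x u i s = x (Sum.inr ⟨i, Fin.rev ⟨s, hs⟩⟩) :=
  dif_pos hs

theorem legValue_pos {x : AttachVert V a → ℝ} (hx : ∀ p, 0 < x p) (u : V) (i : Fin a.length)
    (s : ℕ) : 0 < legValue x u i s := by
  unfold legValue
  split_ifs <;> exact hx _

variable [Fintype V]

theorem alphaMatrix_attachPaths_mulVec_inl [DecidableEq V] (ha : ∀ k ∈ a, 0 < k)
    (x : AttachVert V a → ℝ) (v : V) :
    (alphaMatrix (attachPaths G u a) α *ᵥ x) (Sum.inl v)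
      = (alphaMatrix G α *ᵥ (x ∘ Sum.inl)) v + (Pi.single u (∑ i : Fin a.length,
          (α * x (Sum.inl u) + (1 - α) * legValue x u i (a.get i - 1))) : V → ℝ) v := by
  classical
  rw [alphaMatrix_mulVec_apply, alphaMatrix_mulVec_apply, Fintype.sum_sum_type, Fintype.sum_sigma]
  congr 1
  rcases eq_or_ne v u with rfl | hv
  · rw [Pi.single_eq_same]
    refine Finset.sum_congr rfl fun i _ => ?_
    have hi : 0 < a.get i := ha _ (List.get_mem a i)
    have hrev : Fin.rev ⟨a.get i - 1, by omega⟩ = (⟨0, hi⟩ : Fin (a.get i)) := by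
      ext
      simp only [Fin.val_rev]
      omega
    rw [legValue_of_lt x v i (by omega), hrev, Fintype.sum_eq_single ⟨0, hi⟩]
    · exact if_pos ⟨rfl, rfl⟩
    · exact fun j hj => if_neg fun h => hj (Fin.ext h.2)
  · rw [Pi.single_eq_of_ne hv]
    exact Finset.sum_eq_zero fun i _ => Finset.sum_eq_zero fun j _ => if_neg fun h => hv h.1

theorem alphaMatrix_attachPaths_mulVec_inr (x : AttachVert V a → ℝ) (i : Fin a.length)
    (s : Fin (a.get i)) :
    (alphaMatrix (attachPaths G u a) α *ᵥ x) (Sum.inr ⟨i, s.rev⟩)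
      = ∑ k ∈ Finset.range (a.get i + 1), if (s : ℕ) + 1 = k ∨ k + 1 = (s : ℕ) then
          α * legValue x u i s + (1 - α) * legValue x u i k else 0 := by
  classical
  have hroot : (attachPaths G u a).Adj (Sum.inr ⟨i, s.rev⟩) (Sum.inl u) ↔
      (s : ℕ) + 1 = a.get i ∨ a.get i + 1 = (s : ℕ) := by
    simp only [attachPaths, AttachAdj, Fin.val_rev, true_and]
    omega
  have hleg : ∀ k : Fin (a.get i),
      (attachPaths G u a).Adj (Sum.inr ⟨i, s.rev⟩) (Sum.inr ⟨i, k.rev⟩) ↔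
        (s : ℕ) + 1 = k ∨ (k : ℕ) + 1 = s := fun k => by
    simp only [attachPaths, AttachAdj, Fin.val_rev, true_and]
    omega
  rw [alphaMatrix_mulVec_apply, Fintype.sum_sum_type, Fintype.sum_sigma,
    Fintype.sum_eq_single u fun v hv => if_neg fun h => hv h.1,
    Fintype.sum_eq_single i fun k hk => Finset.sum_eq_zero fun l _ => if_neg fun h => hk h.1.symm,
    ← Equiv.sum_comp Fin.revPerm, Finset.sum_range_succ, ← Fin.sum_univ_eq_sum_range, add_comm]
  simp only [Fin.revPerm_apply, hleg, hroot, legValue_length, legValue_of_lt x u i (Fin.is_lt _)]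

theorem alphaMatrix_attachPaths_mulVec_leaf (x : AttachVert V a → ℝ) (i : Fin a.length)
    (hi : 0 < a.get i) :
    (alphaMatrix (attachPaths G u a) α *ᵥ x) (Sum.inr ⟨i, Fin.rev ⟨0, hi⟩⟩)
      = α * legValue x u i 0 + (1 - α) * legValue x u i 1 := by
  rw [alphaMatrix_attachPaths_mulVec_inr,
    Finset.sum_eq_single_of_mem 1 (Finset.mem_range.2 (Nat.succ_lt_succ hi))]
  · exact if_pos (Or.inl rfl)
  · exact fun k _ hk => if_neg (by simp only; omega)

theorem alphaMatrix_attachPaths_mulVec_inner (x : AttachVert V a → ℝ) (i : Fin a.length) {s : ℕ}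
    (hs : s + 1 < a.get i) :
    (alphaMatrix (attachPaths G u a) α *ᵥ x) (Sum.inr ⟨i, Fin.rev ⟨s + 1, hs⟩⟩)
      = 2 * α * legValue x u i (s + 1)
        + (1 - α) * (legValue x u i s + legValue x u i (s + 2)) := by
  rw [alphaMatrix_attachPaths_mulVec_inr,
    Finset.sum_eq_add_of_mem s (s + 2) (Finset.mem_range.2 (by omega))
      (Finset.mem_range.2 (by omega)) (by omega)]
  · rw [if_pos (Or.inr rfl), if_pos (Or.inl rfl)]
    ring
  · exact fun k _ hk => if_neg (by simp only; omega)

section Restrict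

variable {ρ β c : ℝ} {x : AttachVert V a → ℝ}

theorem legValid_of_alphaMatrix_mulVec_le (hα1 : α < 1) (hβ : (1 - α) * β = α)
    (hc : (1 - α) * c = ρ - 2 * α) (hx : ∀ p, 0 < x p)
    (hAx : alphaMatrix (attachPaths G u a) α *ᵥ x ≤ ρ • x) (i : Fin a.length) :
    LegValid β c (a.get i) ∧ ∀ s < a.get i,
      legRatio β c (s + 1) * legValue x u i (s + 1) ≤ legValue x u i s := by
  refine legValid_of_supersolution (fun s _ => legValue_pos hx u i s) (fun hi => ?_)
    fun s hs => ?_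
  · have h := hAx (Sum.inr ⟨i, Fin.rev ⟨0, hi⟩⟩)
    rw [alphaMatrix_attachPaths_mulVec_leaf, Pi.smul_apply, smul_eq_mul,
      ← legValue_of_lt x u i] at h
    refine le_of_mul_le_mul_left ?_ (sub_pos.2 hα1)
    linear_combination h - legValue x u i 0 * (hc + hβ)
  · have h := hAx (Sum.inr ⟨i, Fin.rev ⟨s + 1, hs⟩⟩)
    rw [alphaMatrix_attachPaths_mulVec_inner, Pi.smul_apply, smul_eq_mul,
      ← legValue_of_lt x u i] at h
    refine le_of_mul_le_mul_left ?_ (sub_pos.2 hα1)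
    linear_combination h - legValue x u i (s + 1) * hc

theorem LegValid.legValue_le_of_le_alphaMatrix_mulVec {i : Fin a.length}
    (hv : LegValid β c (a.get i)) (hα1 : α < 1) (hβ : (1 - α) * β = α)
    (hc : (1 - α) * c = ρ - 2 * α) (hAx : ρ • x ≤ alphaMatrix (attachPaths G u a) α *ᵥ x) {s : ℕ}
    (hs : s < a.get i) : legValue x u i s ≤ legRatio β c (s + 1) * legValue x u i (s + 1) := by
  refine hv.le_legRatio_mul_of_subsolution (fun hi => ?_) (fun s hs => ?_) hs
  · have h := hAx (Sum.inr ⟨i, Fin.rev ⟨0, hi⟩⟩)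
    rw [alphaMatrix_attachPaths_mulVec_leaf, Pi.smul_apply, smul_eq_mul,
      ← legValue_of_lt x u i] at h
    refine le_of_mul_le_mul_left ?_ (sub_pos.2 hα1)
    linear_combination h + legValue x u i 0 * (hc + hβ)
  · have h := hAx (Sum.inr ⟨i, Fin.rev ⟨s + 1, hs⟩⟩)
    rw [alphaMatrix_attachPaths_mulVec_inner, Pi.smul_apply, smul_eq_mul,
      ← legValue_of_lt x u i] at h
    refine le_of_mul_le_mul_left ?_ (sub_pos.2 hα1)
    linear_combination h + legValue x u i (s + 1) * hc

theorem mul_legWeightSum_mul_eq_sum (hβ : (1 - α) * β = α) (a : List ℕ) (t : ℝ) :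
    (1 - α) * legWeightSum β c a * t
      = ∑ i : Fin a.length, (α * t + (1 - α) * (legRatio β c (a.get i) * t)) := by
  rw [legWeightSum_coe, Finset.mul_sum, Finset.sum_mul]
  refine Finset.sum_congr rfl fun i _ => ?_
  unfold legWeight
  linear_combination t * hβ

theorem alphaMatrix_mulVec_add_single_le [DecidableEq V] (hα1 : α < 1) (ha : ∀ k ∈ a, 0 < k)
    (hβ : (1 - α) * β = α) (hc : (1 - α) * c = ρ - 2 * α) (hx : ∀ p, 0 < x p)
    (hAx : alphaMatrix (attachPaths G u a) α *ᵥ x ≤ ρ • x) :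
    alphaMatrix G α *ᵥ (x ∘ Sum.inl)
        + Pi.single u ((1 - α) * legWeightSum β c a * (x ∘ Sum.inl) u) ≤ ρ • (x ∘ Sum.inl) := by
  intro v
  refine le_trans ?_ (hAx (Sum.inl v))
  rw [alphaMatrix_attachPaths_mulVec_inl ha, Pi.add_apply, mul_legWeightSum_mul_eq_sum hβ]
  refine add_le_add_right (Pi.single_mono (f := fun _ => ℝ) u (Finset.sum_le_sum fun i _ => ?_) v) _
  have hi : 0 < a.get i := ha _ (List.get_mem a i)
  have h := (legValid_of_alphaMatrix_mulVec_le hα1 hβ hc hx hAx i).2 (a.get i - 1)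
    (Nat.sub_one_lt_of_lt hi)
  rw [Nat.sub_add_cancel hi, legValue_length] at h
  exact add_le_add_right (mul_le_mul_of_nonneg_left h (sub_pos.2 hα1).le) _

theorem le_alphaMatrix_mulVec_add_single [DecidableEq V] (hα1 : α < 1) (ha : ∀ k ∈ a, 0 < k)
    (hβ : (1 - α) * β = α) (hc : (1 - α) * c = ρ - 2 * α) (hva : ∀ k ∈ a, LegValid β c k)
    (hAx : ρ • x ≤ alphaMatrix (attachPaths G u a) α *ᵥ x) :
    ρ • (x ∘ Sum.inl) ≤ alphaMatrix G α *ᵥ (x ∘ Sum.inl)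
        + Pi.single u ((1 - α) * legWeightSum β c a * (x ∘ Sum.inl) u) := by
  intro v
  refine (hAx (Sum.inl v)).trans ?_
  rw [alphaMatrix_attachPaths_mulVec_inl ha, Pi.add_apply, mul_legWeightSum_mul_eq_sum hβ]
  refine add_le_add_right (Pi.single_mono (f := fun _ => ℝ) u (Finset.sum_le_sum fun i _ => ?_) v) _
  have hi : 0 < a.get i := ha _ (List.get_mem a i)
  have h := (hva _ (List.get_mem a i)).legValue_le_of_le_alphaMatrix_mulVec hα1 hβ hc hAx
    (Nat.sub_one_lt_of_lt hi)
  rw [Nat.sub_add_cancel hi, legValue_length] at h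
  exact add_le_add_right (mul_le_mul_of_nonneg_left h (sub_pos.2 hα1).le) _

end Restrict

end AttachPaths

section Comparison

open Matrix

variable {V : Type*} [Fintype V] {G : SimpleGraph V} {u : V} {α : ℝ}

theorem le_of_alphaMatrix_mulVec_add_single_le [DecidableEq V] (hα0 : 0 ≤ α) (hα1 : α ≤ 1)
    {ρ q : ℝ} {x : V → ℝ} (hx : ∀ v, 0 < x v)
    (hsuper : alphaMatrix G α *ᵥ x + Pi.single u (q * x u) ≤ ρ • x) : q ≤ ρ := by
  have hu := hsuper u
  rw [Pi.add_apply, Pi.single_eq_same, Pi.smul_apply, smul_eq_mul] at hu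
  have hpos := alphaMatrix_mulVec_nonneg hα0 hα1 (G := G) (fun v => (hx v).le) u
  exact le_of_mul_le_mul_right (by linarith) (hx u)

theorem lt_of_alphaMatrix_mulVec_add_single_le [Nontrivial V] [DecidableEq V] (hG : G.Connected)
    (hα0 : 0 ≤ α) (hα1 : α < 1) {ρ q : ℝ} {x : V → ℝ} (hx : ∀ v, 0 < x v)
    (hsuper : alphaMatrix G α *ᵥ x + Pi.single u (q * x u) ≤ ρ • x) : q < ρ := by
  have hu := hsuper u
  rw [Pi.add_apply, Pi.single_eq_same, Pi.smul_apply, smul_eq_mul] at hu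
  obtain ⟨w, hw⟩ := hG.preconnected.exists_adj_of_nontrivial u
  have hpos := alphaMatrix_mulVec_pos hα0 hα1 (fun v => (hx v).le) hw (hx w)
  exact lt_of_mul_lt_mul_right (by linarith) (hx u).le

section Bounds

variable {ρ β c : ℝ} {a b : List ℕ}

theorem forall_legValid_of_alphaMatrix_mulVec_le (hα1 : α < 1) (hβ : (1 - α) * β = α)
    (hc : (1 - α) * c = ρ - 2 * α) {x : AttachVert V a → ℝ} (hx : ∀ p, 0 < x p)
    (hAx : alphaMatrix (attachPaths G u a) α *ᵥ x ≤ ρ • x) : ∀ k ∈ a, LegValid β c k :=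
  List.forall_mem_iff_get.2 fun i => (legValid_of_alphaMatrix_mulVec_le hα1 hβ hc hx hAx i).1

theorem legWeightSum_le_of_alphaMatrix_mulVec_le (hα0 : 0 ≤ α) (hα1 : α < 1)
    (ha : ∀ k ∈ a, 0 < k) (hβ : (1 - α) * β = α) (hc : (1 - α) * c = ρ - 2 * α)
    {x : AttachVert V a → ℝ} (hx : ∀ p, 0 < x p)
    (hAx : alphaMatrix (attachPaths G u a) α *ᵥ x ≤ ρ • x) :
    legWeightSum β c a ≤ c + 2 * β := by
  classical
  have hle := le_of_alphaMatrix_mulVec_add_single_le hα0 hα1.le (fun v => hx _)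
    (alphaMatrix_mulVec_add_single_le hα1 ha hβ hc hx hAx)
  refine le_of_mul_le_mul_left ?_ (sub_pos.2 hα1)
  linear_combination hle - hc - 2 * hβ

theorem legWeightSum_lt_of_alphaMatrix_mulVec_le [Nontrivial V] (hG : G.Connected) (hα0 : 0 ≤ α)
    (hα1 : α < 1) (ha : ∀ k ∈ a, 0 < k) (hβ : (1 - α) * β = α) (hc : (1 - α) * c = ρ - 2 * α)
    {x : AttachVert V a → ℝ} (hx : ∀ p, 0 < x p)
    (hAx : alphaMatrix (attachPaths G u a) α *ᵥ x ≤ ρ • x) :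
    legWeightSum β c a < c + 2 * β := by
  classical
  have hlt := lt_of_alphaMatrix_mulVec_add_single_le hG hα0 hα1 (fun v => hx _)
    (alphaMatrix_mulVec_add_single_le hα1 ha hβ hc hx hAx)
  refine lt_of_mul_lt_mul_left ?_ (sub_pos.2 hα1).le
  linear_combination hlt - hc - 2 * hβ

theorem legWeightSum_le_legWeightSum_of_alphaMatrix_mulVec_le (hα1 : α < 1) (ha : ∀ k ∈ a, 0 < k)
    (hb : ∀ k ∈ b, 0 < k) (hβ : (1 - α) * β = α) (hc : (1 - α) * c = ρ - 2 * α)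
    {x : AttachVert V a → ℝ} {z : AttachVert V b → ℝ} (hx : ∀ p, 0 < x p) (hz : ∀ p, 0 < z p)
    (hAx : alphaMatrix (attachPaths G u a) α *ᵥ x = ρ • x)
    (hAz : alphaMatrix (attachPaths G u b) α *ᵥ z ≤ ρ • z) :
    legWeightSum β c b ≤ legWeightSum β c a := by
  classical
  have hva := forall_legValid_of_alphaMatrix_mulVec_le hα1 hβ hc hx hAx.le
  have hsub := le_alphaMatrix_mulVec_add_single hα1 ha hβ hc hva hAx.ge
  have hsuper := alphaMatrix_mulVec_add_single_le hα1 hb hβ hc hz hAz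
  exact le_of_mul_le_mul_left (le_of_subsolution_of_supersolution (alphaMatrix_isHermitian G α)
    (fun v => hx _) (fun v => hz _) hsub hsuper) (sub_pos.2 hα1)

end Bounds

theorem rhoAlpha_attachPaths_lt (hG : G.Connected) (u : V) {n : ℕ} {a b : List ℕ}
    (ha : IsPartition n a) (hb : IsPartition n b) (hab : List.Shortlex (· < ·) a b)
    (hα0 : 0 ≤ α) (hα1 : α < 1) (hex : ¬ (Fintype.card V = 1 ∧ b.length = 2)) :
    rhoAlpha α (attachPaths G u a) < rhoAlpha α (attachPaths G u b) := by
  by_contra! hcon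
  obtain ⟨x, hx, hAx⟩ := exists_pos_alphaMatrix_mulVec_eq (attachPaths_connected hG u a) hα0 hα1
  obtain ⟨z, hz, hAz⟩ := exists_pos_alphaMatrix_mulVec_eq (attachPaths_connected hG u b) hα0 hα1
  set ρ := rhoAlpha α (attachPaths G u a)
  have hAz' : alphaMatrix (attachPaths G u b) α *ᵥ z ≤ ρ • z := fun p =>
    hAz ▸ mul_le_mul_of_nonneg_right hcon (hz p).le
  have h1α : 0 < 1 - α := sub_pos.2 hα1
  have hβ : (1 - α) * (α / (1 - α)) = α := mul_div_cancel₀ _ h1α.ne'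
  have hc : (1 - α) * ((ρ - 2 * α) / (1 - α)) = ρ - 2 * α := mul_div_cancel₀ _ h1α.ne'
  refine (legWeightSum_le_legWeightSum_of_alphaMatrix_mulVec_le hα1 ha.2.1 hb.2.1 hβ hc hx hz hAx
    hAz').not_gt (ha.legWeightSum_lt (div_nonneg hα0 h1α.le) hb hab
      (forall_legValid_of_alphaMatrix_mulVec_le hα1 hβ hc hx hAx.le)
      (forall_legValid_of_alphaMatrix_mulVec_le hα1 hβ hc hz hAz')
      (legWeightSum_le_of_alphaMatrix_mulVec_le hα0 hα1 ha.2.1 hβ hc hx hAx.le)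
      (legWeightSum_le_of_alphaMatrix_mulVec_le hα0 hα1 hb.2.1 hβ hc hz hAz') fun hlen => ?_)
  have : Nonempty V := ⟨u⟩
  have : Nontrivial V := Fintype.one_lt_card_iff_nontrivial.1
    (lt_of_le_of_ne' Fintype.card_pos fun hV => hex ⟨hV, hlen⟩)
  exact legWeightSum_lt_of_alphaMatrix_mulVec_le hG hα0 hα1 hb.2.1 hβ hc hz hAz'

end Comparison

section PathIso

open SimpleGraph

theorem nonempty_iso_pathGraph {W : Type*} [Fintype W] {H : SimpleGraph W} {m : ℤ} {f : W → ℤ}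
    (hf : Function.Injective f) (hmem : ∀ w, f w ∈ Set.Ico m (m + Fintype.card W))
    (hadj : ∀ v w, H.Adj v w ↔ f v + 1 = f w ∨ f w + 1 = f v) :
    Nonempty (H ≃g pathGraph (Fintype.card W)) := by
  let g : W → Fin (Fintype.card W) := fun w => ⟨(f w - m).toNat, by grind⟩
  have hg : ∀ w, ((g w : ℕ) : ℤ) = f w - m := fun w => Int.toNat_of_nonneg (by grind)
  have hinj : Function.Injective g := fun v w h => hf (by grind)
  refine ⟨⟨Equiv.ofBijective g
    ((Fintype.bijective_iff_injective_and_card g).2 ⟨hinj, (Fintype.card_fin _).symm⟩), ?_⟩⟩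
  intro v w
  rw [hadj, pathGraph_adj, Equiv.ofBijective_apply, Equiv.ofBijective_apply]
  have := hg v
  have := hg w
  omega

variable {V : Type*}

theorem card_attachVert [Fintype V] (a : List ℕ) :
    Fintype.card (AttachVert V a) = Fintype.card V + a.sum := by
  simp [Fin.sum_univ_getElem]

/-- The positions on the integer line of the vertices of one or two paths attached to a single
vertex: the vertex is at the origin, the first path to its left and the second to its right. -/
def pathPosition (V : Type*) (a : List ℕ) : AttachVert V a → ℤ
  | Sum.inl _ => 0
  | Sum.inr ⟨i, j⟩ => if (i : ℕ) = 0 then -(j + 1) else j + 1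

theorem pathPosition_injective [Subsingleton V] {a : List ℕ} (ha : a.length ≤ 2) :
    Function.Injective (pathPosition V a) := by
  rintro (v | ⟨i, j⟩) (w | ⟨k, l⟩) h
  · rw [Subsingleton.elim v w]
  · grind [pathPosition]
  · grind [pathPosition]
  · obtain rfl : i = k := by grind [pathPosition]
    obtain rfl : j = l := by grind [pathPosition]
    rfl

theorem attachPaths_adj_iff_pathPosition [Subsingleton V] (G : SimpleGraph V) (u : V) {a : List ℕ}
    (ha : a.length ≤ 2) (p q : AttachVert V a) :
    (attachPaths G u a).Adj p q ↔ pathPosition V a p + 1 = pathPosition V a q ∨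
      pathPosition V a q + 1 = pathPosition V a p := by
  rcases p with v | ⟨i, j⟩ <;> rcases q with w | ⟨k, l⟩ <;>
    simp only [attachPaths, AttachAdj, pathPosition]
  · have : ¬ G.Adj v w := fun h => h.ne (Subsingleton.elim v w)
    simpa only [zero_add, one_ne_zero, or_self, iff_false]
  · simp only [Subsingleton.elim v u, true_and]
    split_ifs <;> omega
  · simp only [Subsingleton.elim w u, true_and]
    split_ifs <;> omega
  · simp only [Fin.ext_iff]
    split_ifs <;> omega

theorem pathPosition_mem_Ico (V : Type*) {a : List ℕ} (ha : a.length ≤ 2) (p : AttachVert V a) :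
    pathPosition V a p ∈ Set.Ico (-a.headI : ℤ) (-a.headI + (1 + a.sum : ℕ)) := by
  rcases p with v | ⟨i, j⟩
  · have := List.headI_le_sum a
    simp only [pathPosition, Set.mem_Ico]
    omega
  · match a, ha, i, j with
    | [x], _, ⟨0, _⟩, ⟨j, (hj : j < x)⟩ =>
      simp only [pathPosition, ↓reduceIte, List.headI_cons, List.sum_cons, Set.mem_Ico]
      omega
    | [x, y], _, ⟨0, _⟩, ⟨j, (hj : j < x)⟩ =>
      simp only [pathPosition, ↓reduceIte, List.headI_cons, List.sum_cons, Set.mem_Ico]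
      omega
    | [x, y], _, ⟨1, _⟩, ⟨j, (hj : j < y)⟩ =>
      simp only [pathPosition, one_ne_zero, ↓reduceIte, List.headI_cons, List.sum_cons, Set.mem_Ico]
      omega

theorem attachPaths_iso_pathGraph [Fintype V] (hV : Fintype.card V = 1) (G : SimpleGraph V) (u : V)
    {a : List ℕ} (ha : a.length ≤ 2) :
    Nonempty (attachPaths G u a ≃g pathGraph (1 + a.sum)) := by
  have : Subsingleton V := Fintype.card_le_one_iff_subsingleton.1 hV.le
  have hcard : Fintype.card (AttachVert V a) = 1 + a.sum := by rw [card_attachVert, hV]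
  rw [← hcard]
  exact nonempty_iso_pathGraph (pathPosition_injective ha)
    (hcard ▸ pathPosition_mem_Ico V ha) (attachPaths_adj_iff_pathPosition G u ha)

end PathIso

theorem theorem2 {V : Type*} [Fintype V] (G : SimpleGraph V) (hG : G.Connected) (u : V)
    (n : ℕ) (a b : List ℕ) (ha : IsPartition n a) (hb : IsPartition n b)
    (hab : List.Shortlex (· < ·) a b) (α : ℝ) (hα0 : 0 ≤ α) (hα1 : α < 1) :
    rhoAlpha α (attachPaths G u a) ≤ rhoAlpha α (attachPaths G u b) ∧
    (rhoAlpha α (attachPaths G u a) = rhoAlpha α (attachPaths G u b) ↔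
      Nonempty (attachPaths G u a ≃g attachPaths G u b)) ∧
    (Nonempty (attachPaths G u a ≃g attachPaths G u b) ↔
      Fintype.card V = 1 ∧ b.length = 2) := by
  have hρ : Nonempty (attachPaths G u a ≃g attachPaths G u b) →
      rhoAlpha α (attachPaths G u a) = rhoAlpha α (attachPaths G u b) :=
    fun ⟨e⟩ => rhoAlpha_eq_of_iso e α
  by_cases hex : Fintype.card V = 1 ∧ b.length = 2
  · have hiso : Nonempty (attachPaths G u a ≃g attachPaths G u b) := by
      obtain ⟨e⟩ := attachPaths_iso_pathGraph hex.1 G u ((length_le_of_shortlex hab).trans hex.2.le)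
      obtain ⟨f⟩ := attachPaths_iso_pathGraph hex.1 G u hex.2.le
      rw [ha.2.2] at e
      rw [hb.2.2] at f
      exact ⟨e.trans f.symm⟩
    exact ⟨(hρ hiso).le, iff_of_true (hρ hiso) hiso, iff_of_true hiso hex⟩
  · have hlt := rhoAlpha_attachPaths_lt hG u ha hb hab hα0 hα1 hex
    have hiso : ¬ Nonempty (attachPaths G u a ≃g attachPaths G u b) := fun h => hlt.ne (hρ h)
    exact ⟨hlt.le, iff_of_false hlt.ne hiso, iff_of_false hiso hex⟩
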